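/- Let $\mathbb{K}=\mathbb{R}$ or $\mathbb{C}$. A \emph{sequence class} $X$ assigns to each Banach space $E$ over $\mathbb{K}$ a Banach space $X(E)$ of $E$-valued sequences, with coordinatewise operations, such that every finitely supported $E$-valued sequence belongs to $X(E)$, $\sup_j\|x_j\|\le\|(x_j)_j\|_{X(E)}$ for every $(x_j)_j\in X(E)$, and $\|e_j\|_{X(\mathbb{K})}=1$ for every canonical unit sequence $e_j$. The class $X$ is \emph{linearly stable} if for all Banach spaces $E,F$ and every bounded linear operator $T\colon E\to F$ the map $(x_j)_j\mapsto(T(x_j))_j$ sends $X(E)$ into $X(F)$ with operator norm $\|T\|$. It is \emph{subsequence invariant} if, for every Banach space $E$, every subsequence of every $(x_j)_j\in X(E)$ belongs to $X(E)$ with norm at most $\|(x_j)_j\|_{X(E)}$. It is \emph{contained in $c_0^w$} if, for every Banach space $E$, every sequence in $X(E)$ is weakly null. For $1\le p<\infty$, let $\ell_p(\cdot)$ be the class of absolutely $p$-summable sequences ($\sum_j\|x_j\|^p<\infty$) and $\ell_p^w$ the class of weakly $p$-summable sequences ($\sum_j|\varphi(x_j)|^p<\infty$ for every $\varphi\in E^*$),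 with their usual norms. Let $\Pi_{\ell_p^w,X;\ell_p(\cdot)}$ be the class of continuous bilinear operators $A\colon E_1\times E_2\to F$ between Banach spaces such that $(A(x_j,y_j))_j\in\ell_p(F)$ whenever $(x_j)_j\in\ell_p^w(E_1)$ and $(y_j)_j\in X(E_2)$. A class of bilinear operators is \emph{symmetric} if, for all Banach spaces $E,F$, whenever it contains $A\colon E\times E\to F$ it also contains its symmetrization $A_s(x,y)=\tfrac12\bigl(A(x,y)+A(y,x)\bigr)$. \textbf{Proposition.} Let $X$ be a linearly stable, subsequence invariant sequence class that is not contained in $c_0^w$. Then, for every $1\le p<\infty$, the ideal $\Pi_{\ell_p^w,X;\ell_p(\cdot)}$ is not symmetric. -/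

import Mathlib

open Filter Topology
open scoped ENNReal

universe u

/-- A sequence class over `𝕜` (`ℝ` or `ℂ`): to each Banach space `E` it assigns a Banach space
`X(E)` of `E`-valued sequences with `c₀₀(E) ⊆ X(E)`, `X(E) ⊆ ℓ_∞(E)` with
`sup_j ‖x_j‖ ≤ ‖x‖_{X(E)}`, and `‖e_j‖_{X(𝕜)} = 1`.
The norm is given as a seminorm; it is definite because of `norm_apply_le`. The scalar field is
viewed as a Banach space in the universe `u` through `ULift`. -/
structure SequenceClass (𝕜 : Type) [RCLike 𝕜] where
  /-- the linear space `X(E)` -/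
  space : ∀ (E : Type u) [NormedAddCommGroup E] [NormedSpace 𝕜 E] [CompleteSpace E],
    Submodule 𝕜 (ℕ → E)
  /-- the norm of `X(E)` -/
  nrm : ∀ (E : Type u) [NormedAddCommGroup E] [NormedSpace 𝕜 E] [CompleteSpace E],
    Seminorm 𝕜 (space E)
  /-- `X(E)` is complete -/
  complete : ∀ (E : Type u) [NormedAddCommGroup E] [NormedSpace 𝕜 E] [CompleteSpace E]
    (v : ℕ → space E),
    (∀ ε : ℝ, 0 < ε → ∃ N, ∀ m, N ≤ m → ∀ n, N ≤ n → nrm E (v m - v n) < ε) →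
    ∃ x : space E, Tendsto (fun n => nrm E (v n - x)) atTop (𝓝 0)
  /-- `c₀₀(E) ⊆ X(E)` -/
  finite_support_mem : ∀ (E : Type u) [NormedAddCommGroup E] [NormedSpace 𝕜 E] [CompleteSpace E]
    (x : ℕ → E), {j | x j ≠ 0}.Finite → x ∈ space E
  /-- `X(E)` embeds in `ℓ_∞(E)` with norm at most one -/
  norm_apply_le : ∀ (E : Type u) [NormedAddCommGroup E] [NormedSpace 𝕜 E] [CompleteSpace E]
    (x : space E) (j : ℕ), ‖(x : ℕ → E) j‖ ≤ nrm E x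
  /-- `‖e_j‖ = 1` in `X(𝕜)` -/
  nrm_unit : ∀ (j : ℕ) (h : (Pi.single j 1 : ℕ → ULift.{u} 𝕜) ∈ space (ULift.{u} 𝕜)),
    nrm (ULift.{u} 𝕜) ⟨Pi.single j 1, h⟩ = 1

namespace SequenceClass

variable {𝕜 : Type} [RCLike 𝕜]

/-- Containment `X ⊆ Y` of sequence classes: `X(E) ⊆ Y(E)` for every Banach space `E`. -/
def Contained (X Y : SequenceClass.{u} 𝕜) : Prop :=
  ∀ (E : Type u) [NormedAddCommGroup E] [NormedSpace 𝕜 E] [CompleteSpace E],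
    X.space E ≤ Y.space E

/-- `X` is linearly stable: every bounded operator `T : E → F` maps `X(E)` to `X(F)`
coordinatewise, and the induced operator `X(E) → X(F)` has operator norm `‖T‖`. -/
def LinearlyStable (X : SequenceClass.{u} 𝕜) : Prop :=
  ∀ (E F : Type u) [NormedAddCommGroup E] [NormedSpace 𝕜 E] [CompleteSpace E]
    [NormedAddCommGroup F] [NormedSpace 𝕜 F] [CompleteSpace F] (T : E →L[𝕜] F),
    ∃ hT : ∀ x : X.space E, (fun j => T ((x : ℕ → E) j)) ∈ X.space F,
      IsLeast {C : ℝ | 0 ≤ C ∧ ∀ x : X.space E, X.nrm F ⟨_, hT x⟩ ≤ C * X.nrm E x} ‖T‖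

/-- `X` is subsequence invariant: subsequences of members of `X(E)` are in `X(E)`, with no larger
norm. -/
def SubsequenceInvariant (X : SequenceClass.{u} 𝕜) : Prop :=
  ∀ (E : Type u) [NormedAddCommGroup E] [NormedSpace 𝕜 E] [CompleteSpace E]
    (x : X.space E) (k : ℕ → ℕ), StrictMono k →
    ∃ h : (fun j => (x : ℕ → E) (k j)) ∈ X.space E, X.nrm E ⟨_, h⟩ ≤ X.nrm E x

/-! ### Construction of the concrete classes -/

theorem complete_of_embedding {V B : Type*} [AddCommGroup V] [Module 𝕜 V]
    [NormedAddCommGroup B] [NormedSpace 𝕜 B] [CompleteSpace B] (T : V →ₗ[𝕜] B)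
    (hT : ∀ (v : ℕ → V) (b : B), Tendsto (fun n => T (v n)) atTop (𝓝 b) → ∃ x, T x = b)
    (v : ℕ → V)
    (hv : ∀ ε : ℝ, 0 < ε → ∃ N, ∀ m, N ≤ m → ∀ n, N ≤ n →
      (normSeminorm 𝕜 B).comp T (v m - v n) < ε) :
    ∃ x : V, Tendsto (fun n => (normSeminorm 𝕜 B).comp T (v n - x)) atTop (𝓝 0) := by
  have hc : CauchySeq fun n => T (v n) := by
    rw [Metric.cauchySeq_iff]
    intro ε hε
    obtain ⟨N, hN⟩ := hv ε hε
    refine ⟨N, fun m hm n hn => ?_⟩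
    have := hN m hm n hn
    simpa [dist_eq_norm] using this
  obtain ⟨b, hb⟩ := cauchySeq_tendsto_of_complete hc
  obtain ⟨x, rfl⟩ := hT v b hb
  refine ⟨x, ?_⟩
  have := tendsto_iff_norm_sub_tendsto_zero.1 hb
  simpa using this

section lp

variable (𝕜) (p : ℝ≥0∞) (E : Type*) [NormedAddCommGroup E] [NormedSpace 𝕜 E]

/-- The linear space `ℓ_p(E)`. -/
def lpSpace : Submodule 𝕜 (ℕ → E) where
  carrier := {x | Memℓp x p}
  add_mem' hx hy := hx.add hy
  zero_mem' := zero_memℓp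
  smul_mem' c _ hx := hx.const_smul c

/-- The identification of `ℓ_p(E)` with Mathlib's normed space `lp`. -/
def lpEmb : lpSpace 𝕜 p E →ₗ[𝕜] lp (fun _ : ℕ => E) p where
  toFun x := ⟨x.1, x.2⟩
  map_add' _ _ := rfl
  map_smul' _ _ := rfl

/-- The linear space `ℓ_p^w(E)`: `(φ(x_j))_j ∈ ℓ_p` for every `φ ∈ E*`. -/
def weakLpSpace : Submodule 𝕜 (ℕ → E) where
  carrier := {x | ∀ φ : StrongDual 𝕜 E, Memℓp (fun j => φ (x j)) p}
  add_mem' {x y} hx hy φ := by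
    have := (hx φ).add (hy φ)
    convert this using 1
    funext j
    simp
  zero_mem' φ := by
    have := zero_memℓp (E := fun _ : ℕ => 𝕜) (p := p)
    convert this using 1
    funext j
    simp
  smul_mem' c x hx φ := by
    have := (hx φ).const_smul c
    convert this using 1
    funext j
    simp

/-- The linear space `c₀^w(E)` of weakly null sequences. -/
def weakNullSpace : Submodule 𝕜 (ℕ → E) where
  carrier := {x | ∀ φ : StrongDual 𝕜 E, Tendsto (fun j => φ (x j)) atTop (𝓝 0)}
  add_mem' {x y} hx hy φ := by simpa using (hx φ).add (hy φ)
  zero_mem' φ := by simp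
  smul_mem' c x hx φ := by simpa using (hx φ).const_mul c

variable {𝕜 p E}

variable (𝕜 p) in
/-- The scalar Banach space `ℓ_p`. -/
def ScalarLp : Type := lp (fun _ : ℕ => 𝕜) p

noncomputable instance [Fact (1 ≤ p)] : NormedAddCommGroup (ScalarLp 𝕜 p) :=
  inferInstanceAs (NormedAddCommGroup (lp (fun _ : ℕ => 𝕜) p))

noncomputable instance [Fact (1 ≤ p)] : NormedSpace 𝕜 (ScalarLp 𝕜 p) :=
  inferInstanceAs (NormedSpace 𝕜 (lp (fun _ : ℕ => 𝕜) p))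

instance [Fact (1 ≤ p)] : CompleteSpace (ScalarLp 𝕜 p) :=
  inferInstanceAs (CompleteSpace (lp (fun _ : ℕ => 𝕜) p))

/-- The linear map `φ ↦ (φ(x_j))_j` from `E*` to `ℓ_p`, for `x ∈ ℓ_p^w(E)`. -/
def weakLpLin [Fact (1 ≤ p)] (x : weakLpSpace 𝕜 p E) : StrongDual 𝕜 E →ₗ[𝕜] ScalarLp 𝕜 p where
  toFun φ := ⟨fun j => φ (x.1 j), x.2 φ⟩
  map_add' _ _ := rfl
  map_smul' _ _ := rfl

theorem lp_apply_tendsto [Fact (1 ≤ p)] {F : Type*} [NormedAddCommGroup F]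
    {v : ℕ → lp (fun _ : ℕ => F) p} {b : lp (fun _ : ℕ => F) p}
    (h : Tendsto v atTop (𝓝 b)) (j : ℕ) :
    Tendsto (fun n => (v n : ∀ _ : ℕ, F) j) atTop (𝓝 ((b : ∀ _ : ℕ, F) j)) :=
  ((lp.lipschitzWith_one_eval (E := fun _ : ℕ => F) p j).continuous.tendsto b).comp h

theorem weakLpLin_continuous [Fact (1 ≤ p)] (x : weakLpSpace 𝕜 p E) :
    Continuous (weakLpLin x) := by
  refine (weakLpLin x).continuous_of_seq_closed_graph fun v φ y hv hy => ?_
  refine lp.ext (funext fun j => ?_)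
  have h1 := lp_apply_tendsto hy j
  have h2 : Tendsto (fun n => v n (x.1 j)) atTop (𝓝 (φ (x.1 j))) :=
    ((ContinuousLinearMap.apply 𝕜 𝕜 (x.1 j)).continuous.tendsto φ).comp hv
  exact tendsto_nhds_unique h1 h2

variable (𝕜 p E)

/-- The Banach space `L(E*, ℓ_p)` with the operator norm. -/
def DualToLp [Fact (1 ≤ p)] : Type _ := StrongDual 𝕜 E →L[𝕜] ScalarLp 𝕜 p

noncomputable instance [Fact (1 ≤ p)] : NormedAddCommGroup (DualToLp 𝕜 p E) :=
  inferInstanceAs (NormedAddCommGroup (StrongDual 𝕜 E →L[𝕜] ScalarLp 𝕜 p))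

noncomputable instance [Fact (1 ≤ p)] : NormedSpace 𝕜 (DualToLp 𝕜 p E) :=
  inferInstanceAs (NormedSpace 𝕜 (StrongDual 𝕜 E →L[𝕜] ScalarLp 𝕜 p))

instance [Fact (1 ≤ p)] : CompleteSpace (DualToLp 𝕜 p E) :=
  inferInstanceAs (CompleteSpace (StrongDual 𝕜 E →L[𝕜] ScalarLp 𝕜 p))

variable {𝕜 p E} in
/-- The operator `φ ↦ (φ(x_j))_j` in `L(E*, ℓ_p)`, for `x ∈ ℓ_p^w(E)`. -/
def weakLpOp [Fact (1 ≤ p)] (x : weakLpSpace 𝕜 p E) : StrongDual 𝕜 E →L[𝕜] ScalarLp 𝕜 p :=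
  ⟨weakLpLin x, weakLpLin_continuous x⟩

/-- The embedding of `ℓ_p^w(E)` in `L(E*, ℓ_p)`, `x ↦ (φ ↦ (φ(x_j))_j)`. -/
def weakLpEmb [Fact (1 ≤ p)] : weakLpSpace 𝕜 p E →ₗ[𝕜] DualToLp 𝕜 p E where
  toFun x := weakLpOp x
  map_add' x y := ContinuousLinearMap.ext fun φ => lp.ext (funext fun j =>
    map_add φ (x.1 j) (y.1 j))
  map_smul' c x := ContinuousLinearMap.ext fun φ => lp.ext (funext fun j =>
    map_smul φ c (x.1 j))

/-- The norm of `weakLpEmb x` is the usual norm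
`sup {‖(φ(x_j))_j‖_p : φ ∈ E*, ‖φ‖ ≤ 1}` of `ℓ_p^w(E)`. -/
theorem norm_weakLpEmb [Fact (1 ≤ p)] (x : weakLpSpace 𝕜 p E) :
    ‖weakLpEmb 𝕜 p E x‖ =
      sSup ((fun φ : StrongDual 𝕜 E =>
        ‖(⟨fun j => φ (x.1 j), x.2 φ⟩ : lp (fun _ : ℕ => 𝕜) p)‖) '' Metric.closedBall 0 1) :=
  (weakLpOp x).sSup_unitClosedBall_eq_norm.symm

theorem norm_apply_le_weakLpEmb [Fact (1 ≤ p)] (x : weakLpSpace 𝕜 p E) (j : ℕ) :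
    ‖x.1 j‖ ≤ ‖weakLpEmb 𝕜 p E x‖ := by
  refine NormedSpace.norm_le_dual_bound 𝕜 _ (norm_nonneg (weakLpEmb 𝕜 p E x)) fun φ => ?_
  refine le_trans ?_ ((weakLpOp x).le_opNorm φ)
  exact lp.norm_apply_le_norm (E := fun _ : ℕ => 𝕜)
    (zero_lt_one.trans_le (Fact.out : 1 ≤ p)).ne' (weakLpLin x φ) j

theorem weakLpEmb_closed [Fact (1 ≤ p)] [CompleteSpace E] (v : ℕ → weakLpSpace 𝕜 p E)
    (T : DualToLp 𝕜 p E)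
    (hT : Tendsto (fun n => weakLpEmb 𝕜 p E (v n)) atTop (𝓝 T)) :
    ∃ x, weakLpEmb 𝕜 p E x = T := by
  have hc : ∀ j, CauchySeq fun n => (v n).1 j := fun j => by
    have h := hT.cauchySeq
    rw [Metric.cauchySeq_iff] at h ⊢
    intro ε hε
    obtain ⟨N, hN⟩ := h ε hε
    refine ⟨N, fun m hm n hn => lt_of_le_of_lt ?_ (hN m hm n hn)⟩
    rw [dist_eq_norm, dist_eq_norm, ← map_sub]
    exact norm_apply_le_weakLpEmb 𝕜 p E (v m - v n) j
  choose x hx using fun j => cauchySeq_tendsto_of_complete (hc j)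
  let S : StrongDual 𝕜 E →L[𝕜] ScalarLp 𝕜 p := T
  have key : ∀ (φ : StrongDual 𝕜 E), (fun j => φ (x j)) = (S φ).1 := fun φ => by
    funext j
    have h1 : Tendsto (fun n => weakLpOp (v n) φ) atTop (𝓝 (S φ)) :=
      ((ContinuousLinearMap.apply 𝕜 (ScalarLp 𝕜 p) φ).continuous.tendsto S).comp hT
    exact tendsto_nhds_unique ((φ.continuous.tendsto _).comp (hx j)) (lp_apply_tendsto h1 j)
  refine ⟨⟨x, fun φ => ?_⟩, ?_⟩
  · rw [key φ]
    exact (S φ).2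
  · exact ContinuousLinearMap.ext fun φ => lp.ext (key φ)

theorem memℓp_of_finite_support {F : Type*} [NormedAddCommGroup F] {x : ℕ → F}
    (hx : {j | x j ≠ 0}.Finite) : Memℓp x p :=
  (memℓp_zero hx).of_exponent_ge (zero_le (a := p))

theorem weakNull_bounded (x : weakNullSpace 𝕜 E) : Memℓp x.1 ∞ := by
  refine memℓp_infty ?_
  obtain ⟨C, hC⟩ := banach_steinhaus
    (g := fun j => (NormedSpace.inclusionInDoubleDual 𝕜 E (x.1 j) :
      StrongDual 𝕜 E →L[𝕜] 𝕜)) (fun φ => by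
      obtain ⟨C, hC⟩ := (x.2 φ).norm.bddAbove_range
      exact ⟨C, fun j => hC ⟨j, rfl⟩⟩)
  refine ⟨C, ?_⟩
  rintro _ ⟨j, rfl⟩
  have h := (NormedSpace.inclusionInDoubleDualLi (E := E) 𝕜).norm_map (x.1 j)
  exact h.symm.trans_le (hC j)

/-- The embedding of `c₀^w(E)` in `ℓ_∞(E)`. -/
def weakNullEmb : weakNullSpace 𝕜 E →ₗ[𝕜] lp (fun _ : ℕ => E) ∞ where
  toFun x := ⟨x.1, weakNull_bounded 𝕜 E x⟩
  map_add' _ _ := rfl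
  map_smul' _ _ := rfl

theorem weakNullEmb_closed (v : ℕ → weakNullSpace 𝕜 E) (b : lp (fun _ : ℕ => E) ∞)
    (hb : Tendsto (fun n => weakNullEmb 𝕜 E (v n)) atTop (𝓝 b)) :
    ∃ x, weakNullEmb 𝕜 E x = b := by
  let c : ℕ → E := b.1
  refine ⟨⟨c, fun φ => ?_⟩, rfl⟩
  have hu : TendstoUniformly (fun n j => (v n).1 j) c atTop := by
    rw [Metric.tendstoUniformly_iff]
    intro ε hε
    filter_upwards [(Metric.tendsto_nhds.1 hb) ε hε] with n hn j
    refine lt_of_le_of_lt ?_ hn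
    rw [dist_comm, dist_eq_norm, dist_eq_norm]
    exact lp.norm_apply_le_norm ENNReal.top_ne_zero (weakNullEmb 𝕜 E (v n) - b) j
  have hφ : TendstoUniformly (fun n j => φ ((v n).1 j)) (fun j => φ (c j)) atTop :=
    φ.uniformContinuous.comp_tendstoUniformly hu
  rw [Metric.tendsto_nhds]
  intro ε hε
  obtain ⟨n, hn⟩ := (Metric.tendstoUniformly_iff.1 hφ (ε / 2) (half_pos hε)).exists
  filter_upwards [(Metric.tendsto_nhds.1 ((v n).2 φ)) (ε / 2) (half_pos hε)] with j hj
  linarith [dist_triangle (φ (c j)) (φ ((v n).1 j)) 0, hn j]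

end lp

/-- The sequence class `ℓ_p(·)` of absolutely `p`-summable sequences, with the norm
`(∑ ‖x_j‖^p)^{1/p}`. -/
noncomputable def ellp (𝕜 : Type) [RCLike 𝕜] (p : ℝ≥0∞) [Fact (1 ≤ p)] :
    SequenceClass.{u} 𝕜 where
  space E _ _ _ := lpSpace 𝕜 p E
  nrm E _ _ _ := (normSeminorm 𝕜 (lp (fun _ : ℕ => E) p)).comp (lpEmb 𝕜 p E)
  complete E _ _ _ := complete_of_embedding (lpEmb 𝕜 p E)
    fun _ b _ => ⟨⟨b.1, b.2⟩, rfl⟩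
  finite_support_mem E _ _ _ x hx := memℓp_of_finite_support p hx
  norm_apply_le E _ _ _ x j :=
    lp.norm_apply_le_norm (zero_lt_one.trans_le (Fact.out : 1 ≤ p)).ne' (lpEmb 𝕜 p E x) j
  nrm_unit j h := by
    have h1 := lp.norm_single (E := fun _ : ℕ => ULift.{u} 𝕜)
      (zero_lt_one.trans_le (Fact.out : 1 ≤ p)) j (1 : ULift.{u} 𝕜)
    rw [norm_one] at h1
    exact h1

/-- The sequence class `ℓ_p^w` of weakly `p`-summable sequences, with the norm
`sup {(∑ |φ(x_j)|^p)^{1/p} : φ ∈ E*, ‖φ‖ ≤ 1}`. -/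
noncomputable def ellpWeak (𝕜 : Type) [RCLike 𝕜] (p : ℝ≥0∞) [Fact (1 ≤ p)] :
    SequenceClass.{u} 𝕜 where
  space E _ _ _ := weakLpSpace 𝕜 p E
  nrm E _ _ _ := (normSeminorm 𝕜 (DualToLp 𝕜 p E)).comp
    (weakLpEmb 𝕜 p E)
  complete E _ _ _ := complete_of_embedding (weakLpEmb 𝕜 p E) (weakLpEmb_closed 𝕜 p E)
  finite_support_mem E _ _ _ x hx φ := memℓp_of_finite_support p
    (hx.subset fun j hj h0 => hj (by simp [h0]))
  norm_apply_le E _ _ _ x j := norm_apply_le_weakLpEmb 𝕜 p E x j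
  nrm_unit j h := by
    have hp : 0 < p := zero_lt_one.trans_le (Fact.out : 1 ≤ p)
    refine le_antisymm ?_ ?_
    · refine ContinuousLinearMap.opNorm_le_bound _ zero_le_one fun φ => ?_
      have h1 : weakLpOp ⟨Pi.single j 1, h⟩ φ = lp.single p j (φ 1) := by
        refine lp.ext (funext fun i => ?_)
        change φ ((Pi.single j 1 : ℕ → ULift.{u} 𝕜) i) = (Pi.single j (φ 1) : ℕ → 𝕜) i
        rcases eq_or_ne i j with rfl | hij
        · simp
        · simp [hij]
      have h2 : ‖weakLpOp ⟨Pi.single j 1, h⟩ φ‖ = ‖φ 1‖ := by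
        rw [h1]
        exact lp.norm_single (E := fun _ : ℕ => 𝕜) hp j (φ 1)
      refine h2.trans_le ?_
      rw [one_mul]
      simpa using φ.le_opNorm 1
    · have := norm_apply_le_weakLpEmb 𝕜 p (ULift.{u} 𝕜) ⟨Pi.single j 1, h⟩ j
      simpa using this

/-- The sequence class `c₀^w` of weakly null sequences, with the supremum norm. -/
noncomputable def c0Weak (𝕜 : Type) [RCLike 𝕜] : SequenceClass.{u} 𝕜 where
  space E _ _ _ := weakNullSpace 𝕜 E
  nrm E _ _ _ := (normSeminorm 𝕜 (lp (fun _ : ℕ => E) ∞)).comp (weakNullEmb 𝕜 E)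
  complete E _ _ _ := complete_of_embedding (weakNullEmb 𝕜 E) (weakNullEmb_closed 𝕜 E)
  finite_support_mem E _ _ _ x hx φ := by
    refine tendsto_const_nhds.congr' ?_
    have h := hx.isBounded.bddAbove
    obtain ⟨N, hN⟩ := h
    filter_upwards [eventually_gt_atTop N] with j hj
    by_contra h0
    exact absurd (hN (show x j ≠ 0 from fun h1 => h0 (by simp [h1]))) (not_le.2 hj)
  norm_apply_le E _ _ _ x j := lp.norm_apply_le_norm ENNReal.top_ne_zero (weakNullEmb 𝕜 E x) j
  nrm_unit j h := by
    have h1 := lp.norm_single (E := fun _ : ℕ => ULift.{u} 𝕜) (p := ∞)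
      (by simp) j (1 : ULift.{u} 𝕜)
    rw [norm_one] at h1
    exact h1

end SequenceClass

/-- A class of continuous `n`-linear operators between Banach spaces, given by its components
`M(E₁, …, E_n; F)`. -/
def MultilinearClass (𝕜 : Type) [RCLike 𝕜] (n : ℕ) : Type (u + 1) :=
  ∀ (E : Fin n → Type u) [∀ i, NormedAddCommGroup (E i)] [∀ i, NormedSpace 𝕜 (E i)]
    [∀ i, CompleteSpace (E i)] (F : Type u) [NormedAddCommGroup F] [NormedSpace 𝕜 F]
    [CompleteSpace F], Set (ContinuousMultilinearMap 𝕜 E F)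

/-- The class `Π_{X₁, …, X_n; Y}` of `(X₁, …, X_n; Y)`-summing operators. -/
def summingOperators {𝕜 : Type} [RCLike 𝕜] {n : ℕ} (X : Fin n → SequenceClass.{u} 𝕜)
    (Y : SequenceClass.{u} 𝕜) : MultilinearClass.{u} 𝕜 n :=
  fun E _ _ _ F _ _ _ =>
    {A | ∀ x : ∀ i, ℕ → E i, (∀ i, x i ∈ (X i).space (E i)) →
      (fun j => A fun i => x i j) ∈ Y.space F}

/-- The symmetrization `A_s(x₁, …, x_n) = (1/n!) ∑_σ A(x_{σ(1)}, …, x_{σ(n)})`. -/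
noncomputable def symmetrization {𝕜 : Type} [RCLike 𝕜] {n : ℕ} {E F : Type u}
    [NormedAddCommGroup E] [NormedSpace 𝕜 E] [NormedAddCommGroup F] [NormedSpace 𝕜 F]
    (A : ContinuousMultilinearMap 𝕜 (fun _ : Fin n => E) F) :
    ContinuousMultilinearMap 𝕜 (fun _ : Fin n => E) F :=
  ((n.factorial : 𝕜)⁻¹) • ∑ σ : Equiv.Perm (Fin n), A.domDomCongr σ

/-- A class of `n`-linear operators is symmetric if it contains the symmetrizations of its
members. -/
def MultilinearClass.IsSymmetric {𝕜 : Type} [RCLike 𝕜] {n : ℕ}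
    (M : MultilinearClass.{u} 𝕜 n) : Prop :=
  ∀ (E F : Type u) [NormedAddCommGroup E] [NormedSpace 𝕜 E] [CompleteSpace E]
    [NormedAddCommGroup F] [NormedSpace 𝕜 F] [CompleteSpace F]
    (A : ContinuousMultilinearMap 𝕜 (fun _ : Fin n => E) F),
    A ∈ M (fun _ => E) F → symmetrization A ∈ M (fun _ => E) F

/-! The two slots of the class are controlled differently: the first sees weakly `p`-summable
sequences, the second only sequences in `X`, which are merely known to be bounded. On `ℓ_∞` take
`A(x, y) = φ(x) y`, where `φ` is the zeroth coordinate. It is summing because `(φ(x_j))` is in `ℓ_p`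
and `(y_j)` is bounded (`functionalSMul_mem_summingOperators`). Exchanging the slots destroys this.

The unit vectors `e_j` of `ℓ_∞` are weakly `p`-summable (`boundedUnit_mem_weakLpSpace`). For `z` in
`X(G)` and `ψ` in `G*`, linear stability puts `(ψ(z_j) e_0)` in `X(ℓ_∞)`. On this pair `A_s` takes
the value `ψ(z_j) e_j / 2` for `j ≠ 0`, of norm `|ψ(z_j)| / 2`. If `A_s` were summing, `ψ(z_j)`
would tend to `0` for all `z` and `ψ`, so `X` would be contained in `c₀^w`. -/

/-! ### Unit vectors of `ℓ_∞` and their weak summability -/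

/-- The space `ℓ_∞`, in the universe `u`. -/
abbrev BoundedSeq (𝕜 : Type) [RCLike 𝕜] : Type u := lp (fun _ : ℕ => ULift.{u} 𝕜) ∞

/-- The canonical unit vector `e_j` of `ℓ_∞`. -/
noncomputable def boundedUnit (𝕜 : Type) [RCLike 𝕜] (j : ℕ) : BoundedSeq.{u} 𝕜 :=
  lp.single ∞ j (1 : ULift.{u} 𝕜)

theorem norm_boundedUnit {𝕜 : Type} [RCLike 𝕜] (j : ℕ) : ‖boundedUnit.{u} 𝕜 j‖ = 1 :=
  (lp.norm_single (E := fun _ : ℕ => ULift.{u} 𝕜) (by simp) j 1).trans norm_one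

theorem boundedUnit_apply {𝕜 : Type} [RCLike 𝕜] (j i : ℕ) :
    (boundedUnit.{u} 𝕜 j : ℕ → ULift.{u} 𝕜) i = if i = j then 1 else 0 := by
  simp [boundedUnit, Pi.single_apply]

/-- A finite combination of unit vectors of `ℓ_∞` with coefficients in the unit disc has norm at
most one. -/
theorem norm_sum_smul_boundedUnit_le {𝕜 : Type} [RCLike 𝕜] (s : Finset ℕ) (c : ℕ → 𝕜)
    (hc : ∀ j, ‖c j‖ ≤ 1) : ‖∑ j ∈ s, c j • boundedUnit.{u} 𝕜 j‖ ≤ 1 := by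
  refine lp.norm_le_of_forall_le zero_le_one fun i => ?_
  have h : ((∑ j ∈ s, c j • boundedUnit.{u} 𝕜 j : BoundedSeq.{u} 𝕜) : ℕ → ULift.{u} 𝕜) i
      = if i ∈ s then c i • (1 : ULift.{u} 𝕜) else 0 := by
    rw [lp.coeFn_sum, Finset.sum_apply]
    simp only [lp.coeFn_smul, Pi.smul_apply, boundedUnit_apply, smul_ite, smul_zero]
    exact Finset.sum_ite_eq s i _
  rw [h]
  split_ifs
  · rw [norm_smul, norm_one, mul_one]
    exact hc i
  · simp

/-- Supplies the phases that turn a sum of absolute values `∑ |ψ(e_j)|` into one value of `ψ`. -/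
theorem exists_norm_le_one_mul_eq_norm {𝕜 : Type} [RCLike 𝕜] (z : 𝕜) :
    ∃ c : 𝕜, ‖c‖ ≤ 1 ∧ c * z = (‖z‖ : 𝕜) := by
  rcases eq_or_ne z 0 with rfl | hz
  · exact ⟨0, by simp⟩
  · refine ⟨‖z‖ / z, ?_, div_mul_cancel₀ _ hz⟩
    rw [norm_div, RCLike.norm_ofReal, abs_norm, div_self (norm_ne_zero_iff.2 hz)]

/-- The unit vectors of `ℓ_∞` are weakly `p`-summable for every `p ≥ 1`. -/
theorem boundedUnit_mem_weakLpSpace {𝕜 : Type} [RCLike 𝕜] (p : ℝ≥0∞) (hp : 1 ≤ p) :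
    boundedUnit.{u} 𝕜 ∈ SequenceClass.weakLpSpace 𝕜 p (BoundedSeq.{u} 𝕜) := by
  intro ψ
  -- The case `p = 1` suffices, since `ℓ_1 ⊆ ℓ_p`; there it is enough to bound all finite sums by
  -- `‖ψ‖`.
  refine Memℓp.of_exponent_ge (q := 1) (memℓp_gen' (C := ‖ψ‖) fun s => ?_) hp
  choose c hc hcz using fun j => exists_norm_le_one_mul_eq_norm (ψ (boundedUnit.{u} 𝕜 j))
  have h : ψ (∑ j ∈ s, c j • boundedUnit.{u} 𝕜 j)
      = ((∑ j ∈ s, ‖ψ (boundedUnit.{u} 𝕜 j)‖ : ℝ) : 𝕜) := by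
    rw [map_sum]
    simp [hcz]
  have h0 : 0 ≤ ∑ j ∈ s, ‖ψ (boundedUnit.{u} 𝕜 j)‖ := Finset.sum_nonneg fun _ _ => norm_nonneg _
  calc ∑ j ∈ s, ‖ψ (boundedUnit.{u} 𝕜 j)‖ ^ (1 : ℝ≥0∞).toReal
      = ∑ j ∈ s, ‖ψ (boundedUnit.{u} 𝕜 j)‖ := by simp
    _ = ‖ψ (∑ j ∈ s, c j • boundedUnit.{u} 𝕜 j)‖ := by
        rw [h, RCLike.norm_ofReal, abs_of_nonneg h0]
    _ ≤ ‖ψ‖ := ψ.unit_le_opNorm _ (norm_sum_smul_boundedUnit_le s c hc)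

/-- The coordinate functional `x ↦ x_0` on `ℓ_∞`. -/
noncomputable def boundedCoordZero (𝕜 : Type) [RCLike 𝕜] : StrongDual 𝕜 (BoundedSeq.{u} 𝕜) :=
  LinearMap.mkContinuous
    { toFun := fun x => ((x : ℕ → ULift.{u} 𝕜) 0).down
      map_add' := fun _ _ => rfl
      map_smul' := fun _ _ => rfl } 1 fun x => by
    rw [one_mul]
    exact lp.norm_apply_le_norm ENNReal.top_ne_zero x 0

theorem boundedCoordZero_unit {𝕜 : Type} [RCLike 𝕜] (j : ℕ) :
    boundedCoordZero.{u} 𝕜 (boundedUnit.{u} 𝕜 j) = if 0 = j then 1 else 0 := by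
  change ((boundedUnit.{u} 𝕜 j : ℕ → ULift.{u} 𝕜) 0).down = _
  rw [boundedUnit_apply]
  split_ifs <;> rfl

/-! ### The test operator and its symmetrization -/

/-- The bilinear operator `(x, y) ↦ φ(x) y`. -/
noncomputable def functionalSMul {𝕜 : Type} [RCLike 𝕜] {E : Type u} [NormedAddCommGroup E]
    [NormedSpace 𝕜 E] (φ : StrongDual 𝕜 E) :
    ContinuousMultilinearMap 𝕜 (fun _ : Fin 2 => E) E where
  toFun m := φ (m 0) • m 1
  map_update_add' m i x y := by
    fin_cases i <;> simp [Function.update, add_smul]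
  map_update_smul' m i c x := by
    fin_cases i <;> simp [Function.update, smul_smul, mul_comm]
  cont := by fun_prop

theorem functionalSMul_apply {𝕜 : Type} [RCLike 𝕜] {E : Type u} [NormedAddCommGroup E]
    [NormedSpace 𝕜 E] (φ : StrongDual 𝕜 E) (m : Fin 2 → E) :
    functionalSMul φ m = φ (m 0) • m 1 := rfl

theorem symmetrization_functionalSMul_apply {𝕜 : Type} [RCLike 𝕜] {E : Type u}
    [NormedAddCommGroup E] [NormedSpace 𝕜 E] (φ : StrongDual 𝕜 E) (m : Fin 2 → E) :
    symmetrization (functionalSMul φ) m = (2 : 𝕜)⁻¹ • (φ (m 0) • m 1 + φ (m 1) • m 0) := by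
  have h : (Finset.univ : Finset (Equiv.Perm (Fin 2))) = {1, Equiv.swap 0 1} := by decide
  have hne : (1 : Equiv.Perm (Fin 2)) ≠ Equiv.swap 0 1 := by decide
  rw [symmetrization, h, Finset.sum_pair hne]
  simp [functionalSMul_apply]

/-- A bounded multiple of an `ℓ_p` sequence is in `ℓ_p`. -/
theorem memℓp_smul_of_bounded {𝕜 : Type} [RCLike 𝕜] {E : Type*} [NormedAddCommGroup E]
    [NormedSpace 𝕜 E] {p : ℝ≥0∞} (hp0 : p ≠ 0) (hp : p ≠ ∞) {a : ℕ → 𝕜} {y : ℕ → E}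
    (ha : Memℓp a p) (C : ℝ) (hy : ∀ j, ‖y j‖ ≤ C) : Memℓp (fun j => a j • y j) p := by
  have hpos := ENNReal.toReal_pos hp0 hp
  refine memℓp_gen (.of_nonneg_of_le (fun _ => by positivity) (fun j => ?_)
    ((ha.summable hpos).mul_right (C ^ p.toReal)))
  rw [norm_smul, Real.mul_rpow (norm_nonneg _) (norm_nonneg _)]
  gcongr
  exact hy j

/-- All the summability comes from the scalar factor in the first slot; of `X` only the embedding in
`ℓ_∞(E)` is needed. -/
theorem functionalSMul_mem_summingOperators {𝕜 : Type} [RCLike 𝕜] (X : SequenceClass.{u} 𝕜)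
    (p : ℝ≥0∞) [Fact (1 ≤ p)] (hp : p ≠ ∞) {E : Type u} [NormedAddCommGroup E]
    [NormedSpace 𝕜 E] [CompleteSpace E] (φ : StrongDual 𝕜 E) :
    functionalSMul φ ∈ summingOperators ![SequenceClass.ellpWeak 𝕜 p, X]
      (SequenceClass.ellp 𝕜 p) (fun _ => E) E := by
  intro x hx
  have h0 : ∀ ψ : StrongDual 𝕜 E, Memℓp (fun j => ψ (x 0 j)) p := hx 0
  have h1 : x 1 ∈ X.space E := hx 1
  exact memℓp_smul_of_bounded (zero_lt_one.trans_le (Fact.out : 1 ≤ p)).ne' hp (h0 φ) _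
    fun j => X.norm_apply_le E ⟨x 1, h1⟩ j

theorem tendsto_zero_of_memℓp {E : Type*} [NormedAddCommGroup E] {p : ℝ≥0∞} (hp0 : p ≠ 0)
    (hp : p ≠ ∞) {x : ℕ → E} (hx : Memℓp x p) : Tendsto (fun j => ‖x j‖) atTop (𝓝 0) := by
  have hpos := ENNReal.toReal_pos hp0 hp
  have h := (hx.summable hpos).tendsto_atTop_zero.rpow_const
    (p := p.toReal⁻¹) (Or.inr (inv_nonneg.2 hpos.le))
  rw [Real.zero_rpow (inv_ne_zero hpos.ne')] at h
  exact h.congr fun j => Real.rpow_rpow_inv (norm_nonneg _) hpos.ne'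

/-! ### The proposition -/

theorem mainTheorem5 {𝕜 : Type} [RCLike 𝕜] (X : SequenceClass.{u} 𝕜)
    (hstable : X.LinearlyStable) (hsub : X.SubsequenceInvariant)
    (hX : ¬ X.Contained (SequenceClass.c0Weak 𝕜))
    (p : ℝ≥0∞) [Fact (1 ≤ p)] (hp : p ≠ ∞) :
    ¬ (summingOperators ![SequenceClass.ellpWeak 𝕜 p, X]
        (SequenceClass.ellp 𝕜 p)).IsSymmetric := by
  intro hsymm
  refine hX fun G _ _ _ z hz ψ => ?_
  -- The rank-one operator `g ↦ ψ(g) e_0` carries `z` to the line through `e_0`, where the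
  -- coordinate functional `φ` recovers `ψ(z_j)`.
  obtain ⟨hT, -⟩ := hstable G (BoundedSeq.{u} 𝕜) (ψ.smulRight (boundedUnit.{u} 𝕜 0))
  have hy := hT ⟨z, hz⟩
  have hA := hsymm _ _ _
    (functionalSMul_mem_summingOperators X p hp (boundedCoordZero.{u} 𝕜))
  have hmem := hA ![boundedUnit.{u} 𝕜, fun j => ψ (z j) • boundedUnit.{u} 𝕜 0] fun i => by
    fin_cases i
    · exact boundedUnit_mem_weakLpSpace p Fact.out
    · exact hy
  have hlim := tendsto_zero_of_memℓp (zero_lt_one.trans_le (Fact.out : 1 ≤ p)).ne' hp hmem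
  -- The factor `2` cancels the `1/2` of the symmetrization.
  have hlim2 := hlim.const_mul 2
  rw [mul_zero] at hlim2
  refine tendsto_zero_iff_norm_tendsto_zero.2 (hlim2.congr' ?_)
  -- For `j ≠ 0` the term `φ(e_j) ψ(z_j) e_0` vanishes and only the swapped term `ψ(z_j) e_j`
  -- survives; at `j = 0` the two coincide.
  filter_upwards [eventually_ne_atTop 0] with j hj
  rw [symmetrization_functionalSMul_apply]
  simp [boundedCoordZero_unit, hj.symm, norm_smul, norm_boundedUnit]
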